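/- A base station has $M\ge 1$ antennas and there are $K$ user equipments (UEs). The channel of UE $i$ is $\mathbf h_i\sim\mathcal{CN}(\mathbf 0,\beta_i\mathbf I_M)$ with $\beta_i>0$, and $S\subseteq\{1,\dots,K\}$ is the (fixed) set of UEs that transmit the same uplink pilot with power $\rho>0$. The base station receives $$\mathbf y=\sum_{i\in S}\sqrt{\rho}\,\mathbf h_i+\mathbf n,\qquad \mathbf n\sim\mathcal{CN}(\mathbf 0,\sigma^2\mathbf I_M),$$ forms the least-squares estimate $\hat{\mathbf h}_{\mathrm{LS}}=\mathbf y/\sqrt{\rho}$ and the precoding vector $\mathbf w=\sqrt q\,\hat{\mathbf h}_{\mathrm{LS}}/\|\hat{\mathbf h}_{\mathrm{LS}}\|$ with downlink power $q\ge 0$ (with the convention $\mathbf w=\mathbf 0$ if $\hat{\mathbf h}_{\mathrm{LS}}=\mathbf 0$), and UE $k\in S$ receives the downlink pilot signal $$z_k=\mathbf h_k^{\mathrm H}\mathbf w+\eta_k,\qquad \eta_k\sim\mathcal{CN}(0,\sigma^2).$$ For each $k\in S$ the variables $\mathbf h_1,\dots,\mathbf h_K,\mathbf n,\eta_k$ are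 mutually independent. Let $\alpha_S=\sum_{i\in S}\beta_i$. Then for every $k\in S$ the received signal can be expressed as $z_k=g_k+\nu_k$, where $$g_k=\sqrt{\frac12\,\frac{\rho q\beta_k^2}{\rho\alpha_S+\sigma^2}}\;x,\quad x\sim\chi_{2M},\qquad \nu_k\sim\mathcal{CN}\!\left(0,\ \sigma^2+q\beta_k-\frac{\rho q\beta_k^2}{\rho\alpha_S+\sigma^2}\right),$$ the variance of $\nu_k$ being nonnegative, and $g_k$ and $\nu_k$ are independent. Here $\chi_n$ is the chi distribution with $n$ degrees of freedom (the law of the Euclidean norm of $n$ independent standard real Gaussians), and $\mathcal{CN}(0,c)$ is the law of a complex variable whose real and imaginary parts are independent real Gaussians with mean $0$ and variance $c/2$; $\mathcal{CN}(\mathbf 0,c\,\mathbf I_M)$ is the law of $M$ independent $\mathcal{CN}(0,c)$ coordinates. -/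

import Mathlib

open MeasureTheory ProbabilityTheory

noncomputable section

/-- The law `CN(0, c)` of a circularly symmetric complex Gaussian variable of variance `c ≥ 0`:
the real and imaginary parts are independent real Gaussians, each of variance `c / 2`. -/
def complexGaussian (c : ℝ) : Measure ℂ :=
  ((gaussianReal 0 (c / 2).toNNReal).prod (gaussianReal 0 (c / 2).toNNReal)).map
    (fun p : ℝ × ℝ => (p.1 : ℂ) + (p.2 : ℂ) * Complex.I)

/-- The law `CN(0, c I_M)` on `ℂ^M`: independent coordinates, each with law `CN(0, c)`. -/
def complexGaussianVec (M : ℕ) (c : ℝ) : Measure (EuclideanSpace ℂ (Fin M)) :=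
  (Measure.pi (fun _ : Fin M => complexGaussian c)).map (WithLp.toLp 2)

/-- The chi distribution with `n` degrees of freedom: the law of the square root of the sum of
the squares of `n` independent standard real Gaussian variables. -/
def chiDist (n : ℕ) : Measure ℝ :=
  (Measure.pi (fun _ : Fin n => gaussianReal 0 1)).map (fun v => Real.sqrt (∑ i, v i ^ 2))

/-- The signal `y = ∑_{i ∈ S} √ρ h_i + n` received by the base station. -/
def uplinkSignal {K M : ℕ} (S : Finset (Fin K)) (ρ : ℝ)
    (h : Fin K → EuclideanSpace ℂ (Fin M)) (n : EuclideanSpace ℂ (Fin M)) :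
    EuclideanSpace ℂ (Fin M) :=
  ∑ i ∈ S, ((Real.sqrt ρ : ℝ) : ℂ) • h i + n

/-- The least-squares estimate `y / √ρ` of `∑_{i ∈ S} h_i`. -/
def lsEstimate {M : ℕ} (ρ : ℝ) (y : EuclideanSpace ℂ (Fin M)) : EuclideanSpace ℂ (Fin M) :=
  ((1 / Real.sqrt ρ : ℝ) : ℂ) • y

/-- The precoding vector `√q u / ‖u‖` for the channel estimate `u` (Euclidean norm). -/
def precoder {M : ℕ} (q : ℝ) (u : EuclideanSpace ℂ (Fin M)) : EuclideanSpace ℂ (Fin M) :=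
  ((Real.sqrt q / ‖u‖ : ℝ) : ℂ) • u

/-- The downlink pilot signal `z_k = h_kᴴ w + η_k` received by user `k`, where `w` is the precoding
vector formed from the least-squares estimate; `inner ℂ a b = aᴴ b`. -/
def downlinkSignal {K M : ℕ} (S : Finset (Fin K)) (ρ q : ℝ)
    (h : Fin K → EuclideanSpace ℂ (Fin M)) (n : EuclideanSpace ℂ (Fin M)) (η : Fin K → ℂ)
    (k : Fin K) : ℂ :=
  inner ℂ (h k) (precoder q (lsEstimate ρ (uplinkSignal S ρ h n))) + η k

/-- The sum `α_S = ∑_{i ∈ S} β_i` of the channel gains of the users in `S`. -/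
def sumGain {K : ℕ} (S : Finset (Fin K)) (β : Fin K → ℝ) : ℝ := ∑ i ∈ S, β i

end

/-! The estimate is `u = h k + r`, where `r` collects the other users and the scaled noise and is
independent of `h k`. Linear estimation splits `h k = (β k / γ) • u + e` with `γ` the coordinate
variance of `u` and `e` Gaussian and independent of `u` (`hasLaw_add_residual`). As `w` is `u`
rescaled to norm `√q`, the first term contributes the real number `(β k / γ) √q ‖u‖`, a multiple of
a chi variable (`map_norm_complexGaussianVec`). Given `u`, the rest `⟨e, w⟩ + η k` is Gaussian with
a variance depending on `w` only through `‖w‖ ^ 2 = q` (`map_inner_add_complexGaussian`). Its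
conditional law is thus constant, so it is independent of `u`. -/

/-- All Gaussian laws compared below are centred and isotropic, so one constant `c` determines them;
each real coordinate has variance `c / 2`, hence the factor `c / 4`. -/
lemma ext_of_charFun_eq_exp {E : Type*} [NormedAddCommGroup E] [InnerProductSpace ℝ E]
    [CompleteSpace E] [SecondCountableTopology E] [MeasurableSpace E] [BorelSpace E]
    {μ ν : Measure E} [IsFiniteMeasure μ] [IsFiniteMeasure ν] {c : ℝ}
    (hμ : ∀ t, charFun μ t = Complex.exp ((-(c / 4 * ‖t‖ ^ 2) : ℝ) : ℂ))
    (hν : ∀ t, charFun ν t = Complex.exp ((-(c / 4 * ‖t‖ ^ 2) : ℝ) : ℂ)) : μ = ν :=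
  Measure.ext_of_charFun (funext fun t => (hμ t).trans (hν t).symm)

/-! ### Complex Gaussian laws: characteristic functions and null sets. -/

lemma measurable_complex_mk : Measurable (fun p : ℝ × ℝ => (p.1 : ℂ) + (p.2 : ℂ) * Complex.I) := by
  fun_prop

instance isProbabilityMeasure_complexGaussian (c : ℝ) :
    IsProbabilityMeasure (complexGaussian c) :=
  Measure.isProbabilityMeasure_map measurable_complex_mk.aemeasurable

instance isProbabilityMeasure_complexGaussianVec (M : ℕ) (c : ℝ) :
    IsProbabilityMeasure (complexGaussianVec M c) :=
  Measure.isProbabilityMeasure_map (by fun_prop)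

lemma charFun_gaussianReal_zero_mean {c : ℝ} (hc : 0 ≤ c) (t : ℝ) :
    charFun (gaussianReal 0 c.toNNReal) t = Complex.exp ((-(c / 2 * t ^ 2) : ℝ) : ℂ) := by
  rw [charFun_gaussianReal]
  congr 1
  rw [Real.coe_toNNReal _ hc]
  push_cast
  ring

lemma charFun_complexGaussian {c : ℝ} (hc : 0 ≤ c) (t : ℂ) :
    charFun (complexGaussian c) t = Complex.exp ((-(c / 4 * ‖t‖ ^ 2) : ℝ) : ℂ) := by
  have key : charFun (complexGaussian c) t =
      charFun (gaussianReal 0 (c / 2).toNNReal) t.re *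
        charFun (gaussianReal 0 (c / 2).toNNReal) t.im := by
    rw [complexGaussian, charFun_apply, integral_map measurable_complex_mk.aemeasurable (by fun_prop),
      charFun_apply_real, charFun_apply_real, ← integral_prod_mul]
    congr 1 with p
    rw [← Complex.exp_add, Complex.inner]
    congr 1
    simp
    ring
  rw [key, charFun_gaussianReal_zero_mean (by positivity),
    charFun_gaussianReal_zero_mean (by positivity), ← Complex.exp_add, ← Complex.ofReal_add,
    ← Complex.normSq_eq_norm_sq, Complex.normSq_apply]
  congr 2
  ring

lemma charFun_complexGaussianVec {M : ℕ} {c : ℝ} (hc : 0 ≤ c) (t : EuclideanSpace ℂ (Fin M)) :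
    charFun (complexGaussianVec M c) t = Complex.exp ((-(c / 4 * ‖t‖ ^ 2) : ℝ) : ℂ) := by
  rw [complexGaussianVec, charFun_pi]
  simp_rw [charFun_complexGaussian hc]
  rw [← Complex.exp_sum, ← Complex.ofReal_sum, EuclideanSpace.norm_sq_eq, Finset.mul_sum,
    Finset.sum_neg_distrib]

lemma complexGaussian_singleton_zero {c : ℝ} (hc : 0 < c) : complexGaussian c {0} = 0 := by
  rw [complexGaussian, Measure.map_apply measurable_complex_mk (measurableSet_singleton 0)]
  have : NullSingletonClass (gaussianReal 0 (c / 2).toNNReal) :=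
    nullSingletonClass_gaussianReal (by simpa using hc)
  refine measure_mono_null (t := {((0 : ℝ), (0 : ℝ))}) ?_ ?_
  swap
  · rw [← Set.singleton_prod_singleton, Measure.prod_prod, measure_singleton, zero_mul]
  rintro ⟨a, b⟩ hab
  have := Complex.ext_iff.1 hab
  simpa using this

/-- Makes the precoder have norm `√q` almost surely. For `M = 0` the law is a point mass at `0`. -/
lemma complexGaussianVec_singleton_zero {M : ℕ} (hM : 0 < M) {c : ℝ} (hc : 0 < c) :
    complexGaussianVec M c {0} = 0 := by
  rw [complexGaussianVec, Measure.map_apply (by fun_prop) (measurableSet_singleton 0)]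
  have hset : (WithLp.toLp 2 ⁻¹' {(0 : EuclideanSpace ℂ (Fin M))}) =
      Set.univ.pi (fun _ : Fin M => ({0} : Set ℂ)) := by
    ext v
    simp [funext_iff]
  rw [hset, Measure.pi_pi]
  exact Finset.prod_eq_zero (Finset.mem_univ ⟨0, hM⟩) (complexGaussian_singleton_zero hc)

/-! ### Linear images of independent Gaussian vectors. -/

lemma hasLaw_add_complexGaussianVec {Ω : Type*} [MeasurableSpace Ω] {P : Measure Ω}
    [IsProbabilityMeasure P] {M : ℕ} {a b : ℝ} (ha : 0 ≤ a) (hb : 0 ≤ b)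
    {X Y : Ω → EuclideanSpace ℂ (Fin M)} (hX : HasLaw X (complexGaussianVec M a) P)
    (hY : HasLaw Y (complexGaussianVec M b) P) (hXY : IndepFun X Y P) :
    HasLaw (fun ω => X ω + Y ω) (complexGaussianVec M (a + b)) P := by
  have hm : AEMeasurable (fun ω => X ω + Y ω) P := hX.aemeasurable.add hY.aemeasurable
  have := Measure.isProbabilityMeasure_map hm
  refine ⟨hm, ext_of_charFun_eq_exp (c := a + b) (fun t => ?_)
    (charFun_complexGaussianVec (add_nonneg ha hb))⟩
  rw [hXY.charFun_map_fun_add_eq_mul hX.aemeasurable hY.aemeasurable, Pi.mul_apply, hX.map_eq,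
    hY.map_eq, charFun_complexGaussianVec ha, charFun_complexGaussianVec hb, ← Complex.exp_add,
    ← Complex.ofReal_add]
  congr 2
  ring

lemma hasLaw_smul_complexGaussianVec {Ω : Type*} [MeasurableSpace Ω] {P : Measure Ω}
    [IsProbabilityMeasure P] {M : ℕ} {a : ℝ} (ha : 0 ≤ a) (r : ℝ)
    {X : Ω → EuclideanSpace ℂ (Fin M)} (hX : HasLaw X (complexGaussianVec M a) P) :
    HasLaw (fun ω => r • X ω) (complexGaussianVec M (r ^ 2 * a)) P := by
  have hm : AEMeasurable (fun ω => r • X ω) P := hX.aemeasurable.const_smul r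
  have := Measure.isProbabilityMeasure_map hm
  refine ⟨hm, ext_of_charFun_eq_exp (c := r ^ 2 * a) (fun t => ?_)
    (charFun_complexGaussianVec (by positivity))⟩
  rw [charFun_map_smul_comp hX.aemeasurable, hX.map_eq, charFun_complexGaussianVec ha, norm_smul,
    mul_pow, Real.norm_eq_abs, sq_abs]
  congr 2
  ring

lemma hasLaw_sum_complexGaussianVec {Ω ι : Type*} [MeasurableSpace Ω] {P : Measure Ω}
    [IsProbabilityMeasure P] {M : ℕ} {β : ι → ℝ} (hβ : ∀ i, 0 ≤ β i)
    {h : ι → Ω → EuclideanSpace ℂ (Fin M)}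
    (hh : ∀ i, HasLaw (h i) (complexGaussianVec M (β i)) P) (h_indep : iIndepFun h P)
    (s : Finset ι) :
    HasLaw (fun ω => ∑ i ∈ s, h i ω) (complexGaussianVec M (∑ i ∈ s, β i)) P := by
  have hm : AEMeasurable (fun ω => ∑ i ∈ s, h i ω) P :=
    Finset.aemeasurable_fun_sum s fun i _ => (hh i).aemeasurable
  have := Measure.isProbabilityMeasure_map hm
  refine ⟨hm, ext_of_charFun_eq_exp (c := ∑ i ∈ s, β i) (fun t => ?_)
    (charFun_complexGaussianVec (Finset.sum_nonneg fun i _ => hβ i))⟩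
  rw [(h_indep.restrict s).charFun_map_fun_finsetSum_eq_prod fun i _ => (hh i).aemeasurable,
    Finset.prod_apply]
  simp_rw [fun i => (hh i).map_eq, fun i => charFun_complexGaussianVec (hβ i) t]
  rw [← Complex.exp_sum, ← Complex.ofReal_sum, Finset.sum_div, Finset.sum_mul,
    Finset.sum_neg_distrib]

/-- The sum of two independent isotropic complex Gaussian vectors is independent of the residual
of the first one after linear estimation from the sum. -/
lemma hasLaw_add_residual {Ω : Type*} [MeasurableSpace Ω] {P : Measure Ω}
    [IsProbabilityMeasure P] {M : ℕ} {a b : ℝ} (ha : 0 < a) (hb : 0 ≤ b)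
    {X Y : Ω → EuclideanSpace ℂ (Fin M)} (hX : HasLaw X (complexGaussianVec M a) P)
    (hY : HasLaw Y (complexGaussianVec M b) P) (hXY : IndepFun X Y P) :
    HasLaw (fun ω => (X ω + Y ω, X ω - (a / (a + b)) • (X ω + Y ω)))
      ((complexGaussianVec M (a + b)).prod (complexGaussianVec M (a - a ^ 2 / (a + b)))) P := by
  have hab : 0 < a + b := by positivity
  have hv : a - a ^ 2 / (a + b) = a * b / (a + b) := by field_simp; ring
  have hlaw := hX.aemeasurable.prodMk hY.aemeasurable
  have hmap : P.map (fun ω => (X ω, Y ω)) =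
      (complexGaussianVec M a).prod (complexGaussianVec M b) := by
    rw [(indepFun_iff_map_prod_eq_prod_map_map hX.aemeasurable hY.aemeasurable).1 hXY, hX.map_eq,
      hY.map_eq]
  have hmeas : Measurable (fun p : EuclideanSpace ℂ (Fin M) × EuclideanSpace ℂ (Fin M) =>
      (p.1 + p.2, p.1 - (a / (a + b)) • (p.1 + p.2))) := by fun_prop
  refine ⟨hmeas.comp_aemeasurable hlaw, ?_⟩
  have hcomp : P.map (fun ω => (X ω + Y ω, X ω - (a / (a + b)) • (X ω + Y ω))) =
      ((complexGaussianVec M a).prod (complexGaussianVec M b)).map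
        (fun p => (p.1 + p.2, p.1 - (a / (a + b)) • (p.1 + p.2))) := by
    rw [← hmap, AEMeasurable.map_map_of_aemeasurable hmeas.aemeasurable hlaw]
    rfl
  rw [hcomp]
  have := Measure.isProbabilityMeasure_map (μ := (complexGaussianVec M a).prod
    (complexGaussianVec M b)) hmeas.aemeasurable
  rw [← charFun_eq_prod_iff]
  intro t
  obtain ⟨⟨s, r⟩⟩ := t
  rw [Measure.map_map (by fun_prop) hmeas]
  -- The arguments on the right are the adjoint of the linear map, applied to `(s, r)`.
  have key : charFun (((complexGaussianVec M a).prod (complexGaussianVec M b)).map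
        (WithLp.toLp 2 ∘ fun p => (p.1 + p.2, p.1 - (a / (a + b)) • (p.1 + p.2))))
        (WithLp.toLp 2 (s, r)) =
      charFun (complexGaussianVec M a) (s + (b / (a + b)) • r) *
        charFun (complexGaussianVec M b) (s - (a / (a + b)) • r) := by
    rw [charFun_apply, integral_map (by fun_prop) (by fun_prop),
      charFun_apply, charFun_apply, ← integral_prod_mul]
    congr 1 with p
    rw [← Complex.exp_add, ← add_mul, ← Complex.ofReal_add]
    congr 3
    have h1 : (1 : ℝ) - a / (a + b) = b / (a + b) := by field_simp; ring
    simp only [Function.comp_apply, WithLp.prod_inner_apply, inner_add_left, inner_sub_left,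
      inner_add_right, inner_sub_right, real_inner_smul_left, real_inner_smul_right, ← h1]
    ring
  -- The two cross terms in `⟨s, r⟩` get weights `a * (b / (a + b))` and `-b * (a / (a + b))`, which
  -- cancel: this is the independence.
  have hs := norm_add_sq_real s ((b / (a + b)) • r)
  have hr := norm_sub_sq_real s ((a / (a + b)) • r)
  rw [norm_smul, mul_pow, Real.norm_eq_abs, sq_abs, real_inner_smul_right] at hs hr
  rw [key, hv, charFun_complexGaussianVec ha.le, charFun_complexGaussianVec hb,
    charFun_complexGaussianVec hab.le, charFun_complexGaussianVec (by positivity),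
    ← Complex.exp_add, ← Complex.exp_add, ← Complex.ofReal_add, ← Complex.ofReal_add, hs, hr]
  congr 2
  field_simp
  ring

/-- Projecting an isotropic complex Gaussian vector on a fixed vector and adding independent
complex Gaussian noise. -/
lemma map_inner_add_complexGaussian {M : ℕ} {a b : ℝ} (ha : 0 ≤ a) (hb : 0 ≤ b)
    (w : EuclideanSpace ℂ (Fin M)) :
    ((complexGaussianVec M a).prod (complexGaussian b)).map
      (fun p => inner ℂ p.1 w + p.2) = complexGaussian (‖w‖ ^ 2 * a + b) := by
  have hmeas : Measurable (fun p : EuclideanSpace ℂ (Fin M) × ℂ => inner ℂ p.1 w + p.2) := by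
    fun_prop
  have := Measure.isProbabilityMeasure_map (μ := (complexGaussianVec M a).prod
    (complexGaussian b)) hmeas.aemeasurable
  refine ext_of_charFun_eq_exp (c := ‖w‖ ^ 2 * a + b) (fun t => ?_)
    (charFun_complexGaussian (by positivity))
  -- For the real inner products, `t ↦ conj t • w` is the adjoint of `v ↦ ⟨v, w⟩`.
  have key : charFun (((complexGaussianVec M a).prod (complexGaussian b)).map
      (fun p => inner ℂ p.1 w + p.2)) t =
      charFun (complexGaussianVec M a) ((starRingEnd ℂ t) • w) *
        charFun (complexGaussian b) t := by
    rw [charFun_apply, integral_map hmeas.aemeasurable (by fun_prop), charFun_apply,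
      charFun_apply, ← integral_prod_mul]
    congr 1 with p
    rw [← Complex.exp_add, ← add_mul, ← Complex.ofReal_add, inner_add_left]
    congr 4
    have hre (x y : EuclideanSpace ℂ (Fin M)) : inner ℝ x y = (inner ℂ x y).re := by
      simp [PiLp.inner_apply, Complex.inner, mul_comm]
    rw [hre, Complex.inner, inner_smul_right, ← Complex.conj_re]
    simp
  rw [key, charFun_complexGaussianVec ha, charFun_complexGaussian hb, ← Complex.exp_add,
    ← Complex.ofReal_add, norm_smul, RCLike.norm_conj]
  congr 2
  ring

/-- Scaling by `√(2 / c)` gives each real coordinate variance `1`. By isotropy any real isometry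
`ℂ^M ≃ ℝ^(2M)` serves, so the bases are irrelevant. -/
lemma map_norm_complexGaussianVec {M : ℕ} {c : ℝ} (hc : 0 < c) :
    (complexGaussianVec M c).map (fun u => Real.sqrt (2 / c) * ‖u‖) = chiDist (2 * M) := by
  have hdim : Module.finrank ℝ (EuclideanSpace ℂ (Fin M)) =
      Module.finrank ℝ (EuclideanSpace ℝ (Fin (2 * M))) := by
    rw [finrank_real_of_complex, finrank_euclideanSpace_fin, finrank_euclideanSpace_fin]
  let L : EuclideanSpace ℂ (Fin M) ≃ₗᵢ[ℝ] EuclideanSpace ℝ (Fin (2 * M)) :=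
    (stdOrthonormalBasis ℝ _).repr.trans
      ((LinearIsometryEquiv.piLpCongrLeft 2 ℝ ℝ (finCongr hdim)).trans
        (stdOrthonormalBasis ℝ _).repr.symm)
  have hmeas : Measurable (fun u => Real.sqrt (2 / c) • L u) :=
    (L.continuous.const_smul (Real.sqrt (2 / c))).measurable
  have hG : (complexGaussianVec M c).map (fun u => Real.sqrt (2 / c) • L u) =
      (Measure.pi (fun _ : Fin (2 * M) => gaussianReal 0 1)).map (WithLp.toLp 2) := by
    have := Measure.isProbabilityMeasure_map (μ := complexGaussianVec M c) hmeas.aemeasurable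
    have := Measure.isProbabilityMeasure_map
      (μ := Measure.pi (fun _ : Fin (2 * M) => gaussianReal 0 1)) (f := WithLp.toLp 2)
      (by fun_prop)
    refine ext_of_charFun_eq_exp (c := 2) (fun t => ?_) (fun t => ?_)
    · have key : charFun ((complexGaussianVec M c).map (fun u => Real.sqrt (2 / c) • L u)) t =
          charFun (complexGaussianVec M c) (Real.sqrt (2 / c) • L.symm t) := by
        rw [charFun_apply, integral_map hmeas.aemeasurable (by fun_prop), charFun_apply]
        congr 1 with u
        rw [real_inner_smul_left, real_inner_smul_right, ← L.inner_map_map u,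
          L.apply_symm_apply]
      rw [key, charFun_complexGaussianVec hc.le, norm_smul, mul_pow, Real.norm_eq_abs, sq_abs,
        Real.sq_sqrt (by positivity), L.symm.norm_map]
      congr 2
      field_simp
    · have h1 (s : ℝ) : charFun (gaussianReal 0 1) s = Complex.exp ((-(1 / 2 * s ^ 2) : ℝ) : ℂ) := by
        simpa using charFun_gaussianReal_zero_mean zero_le_one s
      rw [charFun_pi]
      simp_rw [h1]
      rw [← Complex.exp_sum, ← Complex.ofReal_sum, EuclideanSpace.norm_sq_eq,
        Finset.sum_neg_distrib, ← Finset.mul_sum]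
      simp only [Real.norm_eq_abs, sq_abs]
      congr 4
      norm_num
  have h1 : chiDist (2 * M) =
      ((Measure.pi (fun _ : Fin (2 * M) => gaussianReal 0 1)).map (WithLp.toLp 2)).map
        (fun v : EuclideanSpace ℝ (Fin (2 * M)) => ‖v‖) := by
    rw [Measure.map_map (by fun_prop) (by fun_prop), chiDist]
    congr 1 with v
    simp [EuclideanSpace.norm_eq]
  rw [h1, ← hG, Measure.map_map (by fun_prop) hmeas]
  congr 1 with u
  simp [norm_smul, abs_of_nonneg (Real.sqrt_nonneg _)]

/-! ### Least-squares estimate and precoder. -/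

lemma lsEstimate_uplinkSignal {K M : ℕ} (S : Finset (Fin K)) {ρ : ℝ} (hρ : 0 < ρ)
    (h : Fin K → EuclideanSpace ℂ (Fin M)) (n : EuclideanSpace ℂ (Fin M)) :
    lsEstimate ρ (uplinkSignal S ρ h n) = ∑ i ∈ S, h i + (1 / Real.sqrt ρ) • n := by
  have hs : ((1 / Real.sqrt ρ : ℝ) : ℂ) * ((Real.sqrt ρ : ℝ) : ℂ) = 1 := by
    rw [← Complex.ofReal_mul, one_div_mul_cancel (Real.sqrt_pos.2 hρ).ne', Complex.ofReal_one]
  rw [lsEstimate, uplinkSignal, ← Finset.smul_sum, smul_add, smul_smul, hs, one_smul,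
    Complex.coe_smul]

lemma norm_precoder {M : ℕ} (q : ℝ) {u : EuclideanSpace ℂ (Fin M)} (hu : u ≠ 0) :
    ‖precoder q u‖ = Real.sqrt q := by
  rw [precoder, norm_smul, Complex.norm_real, norm_div, norm_norm,
    div_mul_cancel₀ _ (norm_ne_zero_iff.2 hu), Real.norm_of_nonneg (Real.sqrt_nonneg _)]

/-- It holds at `u = 0` too, so the splitting of the signal is valid at every `ω`, not just almost
surely. -/
lemma inner_precoder_self {M : ℕ} (q : ℝ) (u : EuclideanSpace ℂ (Fin M)) :
    inner ℂ u (precoder q u) = ((Real.sqrt q * ‖u‖ : ℝ) : ℂ) := by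
  rw [precoder, inner_smul_right, inner_self_eq_norm_sq_to_K]
  rcases eq_or_ne u 0 with rfl | hu
  · simp
  · have : (‖u‖ : ℂ) ≠ 0 := by simpa using hu
    push_cast
    simp only [Complex.coe_algebraMap]
    field_simp

lemma measurable_precoder {M : ℕ} (q : ℝ) :
    Measurable (precoder q : EuclideanSpace ℂ (Fin M) → _) := by
  unfold precoder
  fun_prop

/-! ### Decomposition of the received signal. -/

theorem lemma1 {Ω : Type*} [MeasurableSpace Ω] (P : Measure Ω) [IsProbabilityMeasure P]
    (K M : ℕ) (hM : 0 < M) (S : Finset (Fin K))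
    (ρ q σ : ℝ) (hρ : 0 < ρ) (hq : 0 ≤ q) (β : Fin K → ℝ) (hβ : ∀ i, 0 < β i)
    (h : Fin K → Ω → EuclideanSpace ℂ (Fin M)) (n : Ω → EuclideanSpace ℂ (Fin M))
    (η : Fin K → Ω → ℂ)
    (hh : ∀ i, HasLaw (h i) (complexGaussianVec M (β i)) P)
    (hn : HasLaw n (complexGaussianVec M (σ ^ 2)) P)
    (hη : ∀ k ∈ S, HasLaw (η k) (complexGaussian (σ ^ 2)) P)
    -- for each `k` in `S`, the variables `h_1, …, h_K, n, η_k` are mutually independent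
    (h_indep : iIndepFun h P)
    (hn_indep : IndepFun (fun ω i => h i ω) n P)
    (hη_indep : ∀ k ∈ S, IndepFun (fun ω => ((fun i => h i ω), n ω)) (η k) P) :
    ∀ k ∈ S, ∃ (g x : Ω → ℝ) (ν : Ω → ℂ),
      (∀ ω, downlinkSignal S ρ q (fun i => h i ω) (n ω) (fun i => η i ω) k = (g ω : ℂ) + ν ω) ∧
      (∀ ω, g ω =
        Real.sqrt (1 / 2 * (ρ * q * β k ^ 2 / (ρ * sumGain S β + σ ^ 2))) * x ω) ∧
      HasLaw x (chiDist (2 * M)) P ∧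
      0 ≤ σ ^ 2 + q * β k - ρ * q * β k ^ 2 / (ρ * sumGain S β + σ ^ 2) ∧
      HasLaw ν
        (complexGaussian (σ ^ 2 + q * β k - ρ * q * β k ^ 2 / (ρ * sumGain S β + σ ^ 2))) P ∧
      IndepFun g ν P := by
  intro k hk
  have hβk := hβ k
  -- `τ` is the coordinate variance of interference plus scaled noise.
  set τ : ℝ := ∑ i ∈ S.erase k, β i + σ ^ 2 / ρ with hτ
  have hτ0 : 0 ≤ τ := add_nonneg (Finset.sum_nonneg fun i _ => (hβ i).le) (by positivity)
  set γ : ℝ := β k + τ with hγ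
  have hγ0 : 0 < γ := by positivity
  have hα : ρ * sumGain S β + σ ^ 2 = ρ * γ := by
    rw [sumGain, ← Finset.add_sum_erase S β hk, hγ, hτ]
    field_simp
    ring
  have hratio : ρ * q * β k ^ 2 / (ρ * sumGain S β + σ ^ 2) = q * (β k ^ 2 / γ) := by
    rw [hα]; field_simp
  have hv0 : 0 ≤ β k - β k ^ 2 / γ := by
    rw [sub_nonneg, div_le_iff₀ hγ0, hγ]
    nlinarith [mul_nonneg hβk.le hτ0]
  have hvar : σ ^ 2 + q * β k - ρ * q * β k ^ 2 / (ρ * sumGain S β + σ ^ 2) =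
      q * (β k - β k ^ 2 / γ) + σ ^ 2 := by
    rw [hratio]; ring
  -- the contribution to the channel estimate that is independent of `h k`
  let R : (Fin K → EuclideanSpace ℂ (Fin M)) × EuclideanSpace ℂ (Fin M) →
      EuclideanSpace ℂ (Fin M) := fun p => ∑ i ∈ S.erase k, p.1 i + (1 / Real.sqrt ρ) • p.2
  let U : (Fin K → EuclideanSpace ℂ (Fin M)) × EuclideanSpace ℂ (Fin M) →
      EuclideanSpace ℂ (Fin M) := fun p => p.1 k + R p
  let E : (Fin K → EuclideanSpace ℂ (Fin M)) × EuclideanSpace ℂ (Fin M) →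
      EuclideanSpace ℂ (Fin M) := fun p => p.1 k - (β k / γ) • U p
  have hRm : Measurable R := by fun_prop
  have hUm : Measurable U := by fun_prop
  have hEm : Measurable E := by fun_prop
  let Z : Ω → (Fin K → EuclideanSpace ℂ (Fin M)) × EuclideanSpace ℂ (Fin M) :=
    fun ω => ((fun i => h i ω), n ω)
  let u : Ω → EuclideanSpace ℂ (Fin M) := fun ω => U (Z ω)
  let e : Ω → EuclideanSpace ℂ (Fin M) := fun ω => E (Z ω)
  have hest (ω : Ω) : lsEstimate ρ (uplinkSignal S ρ (fun i => h i ω) (n ω)) = u ω := by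
    rw [lsEstimate_uplinkSignal S hρ, ← Finset.add_sum_erase S _ hk, add_assoc]
  have hs_indep : IndepFun (h k) (fun ω => ∑ i ∈ S.erase k, h i ω) P := by
    have := h_indep.indepFun_finsetSum_of_notMem₀ (fun i => (hh i).aemeasurable)
      (Finset.notMem_erase k S)
    convert this.symm using 1
    ext1 ω
    simp
  have hs_law := hasLaw_sum_complexGaussianVec (fun i => (hβ i).le) hh h_indep (S.erase k)
  have hn_law := hasLaw_smul_complexGaussianVec (sq_nonneg σ) (1 / Real.sqrt ρ) hn
  have hpair : IndepFun (fun ω => (h k ω, ∑ i ∈ S.erase k, h i ω))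
      (fun ω => (1 / Real.sqrt ρ) • n ω) P :=
    hn_indep.comp (φ := fun v => (v k, ∑ i ∈ S.erase k, v i))
      (ψ := fun v => (1 / Real.sqrt ρ) • v) (by fun_prop) (by fun_prop)
  have hr_law : HasLaw (fun ω => R (Z ω)) (complexGaussianVec M τ) P := by
    have hc : (1 / Real.sqrt ρ) ^ 2 * σ ^ 2 = σ ^ 2 / ρ := by
      rw [div_pow, Real.sq_sqrt hρ.le]; ring
    rw [hc] at hn_law
    exact hasLaw_add_complexGaussianVec (Finset.sum_nonneg fun i _ => (hβ i).le)
      (by positivity) hs_law hn_law (hpair.comp measurable_snd measurable_id)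
  have hr_indep : IndepFun (h k) (fun ω => R (Z ω)) P := by
    have hkm := (hh k).aemeasurable
    have hsm := hs_law.aemeasurable
    have hnm := hn_law.aemeasurable
    -- The joint law of the three vectors is a product; reassociating it separates `h k` from the
    -- other two.
    have htriple : IndepFun (h k) (fun ω => (∑ i ∈ S.erase k, h i ω, (1 / Real.sqrt ρ) • n ω)) P := by
      have h1 := (indepFun_iff_map_prod_eq_prod_map_map (hkm.prodMk hsm) hnm).1 hpair
      rw [(indepFun_iff_map_prod_eq_prod_map_map hkm hsm).1 hs_indep] at h1
      have h2 := (indepFun_iff_map_prod_eq_prod_map_map hsm hnm).1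
        (hpair.comp measurable_snd measurable_id)
      have := Measure.isProbabilityMeasure_map hkm
      have := Measure.isProbabilityMeasure_map hsm
      have := Measure.isProbabilityMeasure_map hnm
      rw [indepFun_iff_map_prod_eq_prod_map_map hkm (hsm.prodMk hnm), h2,
        ← Measure.prodAssoc_prod, ← h1, AEMeasurable.map_map_of_aemeasurable
          MeasurableEquiv.prodAssoc.measurable.aemeasurable ((hkm.prodMk hsm).prodMk hnm)]
      rfl
    exact htriple.comp (φ := id) (ψ := fun p => p.1 + p.2) measurable_id (by fun_prop)
  have hue_law : HasLaw (fun ω => (u ω, e ω))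
      ((complexGaussianVec M γ).prod (complexGaussianVec M (β k - β k ^ 2 / γ))) P :=
    hasLaw_add_residual hβk hτ0 (hh k) hr_law hr_indep
  have hue_indep : IndepFun (fun ω => (u ω, e ω)) (η k) P :=
    (hη_indep k hk).comp (φ := fun p => (U p, E p)) (ψ := id) (by fun_prop) measurable_id
  have hlaw : HasLaw (fun ω => (u ω, (e ω, η k ω))) ((complexGaussianVec M γ).prod
      ((complexGaussianVec M (β k - β k ^ 2 / γ)).prod (complexGaussian (σ ^ 2)))) P := by
    have h1 := (indepFun_iff_map_prod_eq_prod_map_map hue_law.aemeasurable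
      (hη k hk).aemeasurable).1 hue_indep
    rw [hue_law.map_eq, (hη k hk).map_eq] at h1
    have hm := hue_law.aemeasurable.prodMk (hη k hk).aemeasurable
    refine ⟨MeasurableEquiv.prodAssoc.measurable.comp_aemeasurable hm, ?_⟩
    rw [← Measure.prodAssoc_prod, ← h1, AEMeasurable.map_map_of_aemeasurable
      MeasurableEquiv.prodAssoc.measurable.aemeasurable hm]
    rfl
  let ν : Ω → ℂ := fun ω => inner ℂ (e ω) (precoder q (u ω)) + η k ω
  have hprec := measurable_precoder (M := M) q
  -- For almost every fixed `u` the fibre map has the same image law, so the pair `(u, ν)` has a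
  -- product law.
  have hskew := (MeasurePreserving.id (complexGaussianVec M γ)).skew_product
    (μc := (complexGaussianVec M (β k - β k ^ 2 / γ)).prod (complexGaussian (σ ^ 2)))
    (μd := complexGaussian (q * (β k - β k ^ 2 / γ) + σ ^ 2))
    (g := fun u p => inner ℂ p.1 (precoder q u) + p.2)
    (by unfold Function.uncurry; fun_prop)
    (by
      have h0 : ∀ᵐ u ∂(complexGaussianVec M γ), u ≠ 0 := by
        rw [ae_iff]
        simpa using complexGaussianVec_singleton_zero hM hγ0
      filter_upwards [h0] with u hu
      rw [map_inner_add_complexGaussian hv0 (sq_nonneg σ), norm_precoder q hu, Real.sq_sqrt hq])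
  have huν : HasLaw (fun ω => (u ω, ν ω)) ((complexGaussianVec M γ).prod
      (complexGaussian (q * (β k - β k ^ 2 / γ) + σ ^ 2))) P :=
    hskew.fun_comp_hasLaw hlaw
  have hu_law : HasLaw u (complexGaussianVec M γ) P :=
    measurePreserving_fst.fun_comp_hasLaw huν
  have hν_law : HasLaw ν (complexGaussian (q * (β k - β k ^ 2 / γ) + σ ^ 2)) P :=
    measurePreserving_snd.fun_comp_hasLaw huν
  have huν_indep : IndepFun u ν P := by
    rw [indepFun_iff_map_prod_eq_prod_map_map hu_law.aemeasurable hν_law.aemeasurable,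
      huν.map_eq, hu_law.map_eq, hν_law.map_eq]
  refine ⟨fun ω => β k / γ * (Real.sqrt q * ‖u ω‖), fun ω => Real.sqrt (2 / γ) * ‖u ω‖, ν,
    fun ω => ?_, fun ω => ?_, ?_, ?_, ?_, ?_⟩
  · have hdecomp : h k ω = ((β k / γ : ℝ) : ℂ) • u ω + e ω := by
      rw [Complex.coe_smul]
      exact (add_sub_cancel _ _).symm
    rw [downlinkSignal, hest]
    simp only [ν]
    rw [hdecomp, inner_add_left, inner_smul_left, inner_precoder_self, Complex.conj_ofReal,
      ← Complex.ofReal_mul, add_assoc]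
  · simp only
    rw [← mul_assoc, ← mul_assoc, hratio, ← Real.sqrt_mul (by positivity)]
    congr 1
    rw [show 1 / 2 * (q * (β k ^ 2 / γ)) * (2 / γ) = (β k / γ) ^ 2 * q by field_simp,
      Real.sqrt_mul (by positivity), Real.sqrt_sq (by positivity)]
  · exact HasLaw.fun_comp (X := u) (Y := fun v => Real.sqrt (2 / γ) * ‖v‖) ⟨by fun_prop, map_norm_complexGaussianVec hγ0⟩ hu_law
  · rw [hvar]; positivity
  · rw [hvar]; exact hν_law
  · exact huν_indep.comp (φ := fun v => β k / γ * (Real.sqrt q * ‖v‖)) (ψ := id)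
      (by fun_prop) measurable_id
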